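/- Let $n \ge 0$ and let $\pi = \pi_1\cdots\pi_n$ be a permutation of $[n] = \{1,\dots,n\}$ (not assumed irreducible), drawn as the set of dots $\Pi = \{(i,\pi_i) : i \in [n]\}$ in an $n\times n$ grid, where $(i,j)$ denotes the cell in column $i$ (numbered from left to right) and row $j$ (numbered from top to bottom). A \emph{complete non-ambiguous tree} (CNAT) is a set of dotted cells in a rectangular grid such that: every row and every column contains a dotted cell; every dotted cell other than the top-left cell has either a dotted cell above it in its column or a dotted cell to its left in its row, but not both; and every dotted cell has either both a dotted cell below it in its column and a dotted cell to its right in its row, or neither. A \emph{leaf dot} is a dotted cell with no dotted cell below it in its column and none to its right in its row. The \emph{CNATs of $\pi$} are the CNATs in the $n \times n$ grid whose set of leaf dots is exactly $\Pi$. The permutation $\pi$ satisfies the \emph{quadrant condition} if for every $k \in \{2,\dots,n\}$ $$\bigl|\Pi \cap ([1,k-1]\times[k,n])\bigr| = \bigl|\Pi \cap ([k,n]\times[1,k-1])\bigr| = 1 .$$ Then $\pi$ has exactly $2$ CNATs if and only if $\pi$ satisfies the quadrant condition and has a unique fixed point $j$ (that is, exactly one $j \in [n]$ with $\pi_j = j$),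 and this fixed point satisfies $j \ge 2$. -/

import Mathlib

/-! Cells of a grid with `c` columns and `r` rows are pairs `(column, row)` in `Fin c × Fin r`;
columns are numbered from left to right and rows from top to bottom.  The index `i : Fin n` stands
for the column or row with label `i + 1`, so that labels run from `1` to `n`.  A filling of the
grid is the finite set of its dotted cells. -/

namespace NonAmbiguousTree

/-- There is a dotted cell above `d` in its column. -/
def HasAbove {c r : ℕ} (T : Finset (Fin c × Fin r)) (d : Fin c × Fin r) : Prop :=
  ∃ y : Fin r, y < d.2 ∧ (d.1, y) ∈ T

/-- There is a dotted cell to the left of `d` in its row. -/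
def HasLeft {c r : ℕ} (T : Finset (Fin c × Fin r)) (d : Fin c × Fin r) : Prop :=
  ∃ x : Fin c, x < d.1 ∧ (x, d.2) ∈ T

/-- There is a dotted cell below `d` in its column. -/
def HasBelow {c r : ℕ} (T : Finset (Fin c × Fin r)) (d : Fin c × Fin r) : Prop :=
  ∃ y : Fin r, d.2 < y ∧ (d.1, y) ∈ T

/-- There is a dotted cell to the right of `d` in its row. -/
def HasRight {c r : ℕ} (T : Finset (Fin c × Fin r)) (d : Fin c × Fin r) : Prop :=
  ∃ x : Fin c, d.1 < x ∧ (x, d.2) ∈ T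

/-- The cell `d` is the top-left cell of the grid. -/
def IsTopLeft {c r : ℕ} (d : Fin c × Fin r) : Prop :=
  (d.1 : ℕ) = 0 ∧ (d.2 : ℕ) = 0

/-- Non-ambiguous trees: every column and every row contains a dotted cell, and every dotted cell
other than the top-left one has a dotted cell above it in its column or to its left in its row,
but not both. -/
structure IsNAT {c r : ℕ} (T : Finset (Fin c × Fin r)) : Prop where
  column_nonempty : ∀ x : Fin c, ∃ y : Fin r, (x, y) ∈ T
  row_nonempty : ∀ y : Fin r, ∃ x : Fin c, (x, y) ∈ T
  unique_parent : ∀ d ∈ T, ¬ IsTopLeft d →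
    (HasAbove T d ∧ ¬ HasLeft T d) ∨ (¬ HasAbove T d ∧ HasLeft T d)

/-- Complete non-ambiguous trees: every dot has both a dot below it in its column and a dot to its
right in its row, or neither of these. -/
structure IsCNAT {c r : ℕ} (T : Finset (Fin c × Fin r)) : Prop extends IsNAT T where
  complete : ∀ d ∈ T, (HasBelow T d ∧ HasRight T d) ∨ (¬ HasBelow T d ∧ ¬ HasRight T d)

/-- The leaf dots: dots with no dot below them in their column or to their right in their row. -/
def leafDots {c r : ℕ} (T : Finset (Fin c × Fin r)) : Set (Fin c × Fin r) :=
  {d | d ∈ T ∧ ¬ HasBelow T d ∧ ¬ HasRight T d}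

/-- The graphical representation of a permutation `π`: the dots in column `i` and row `π i`. -/
def dots {n : ℕ} (π : Equiv.Perm (Fin n)) : Finset (Fin n × Fin n) :=
  Finset.univ.image fun i => (i, π i)

/-- The CNATs whose associated permutation is `π`, that is, whose leaf dots form the graphical
representation of `π`. -/
def CNATs {n : ℕ} (π : Equiv.Perm (Fin n)) : Set (Finset (Fin n × Fin n)) :=
  {T | IsCNAT T ∧ leafDots T = (dots π : Set (Fin n × Fin n))}

/-- The number of CNATs whose associated permutation is `π`. -/
noncomputable def cnat {n : ℕ} (π : Equiv.Perm (Fin n)) : ℕ :=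
  (CNATs π).ncard

/-- The label, between `1` and `n`, of a column or row. -/
def label {n : ℕ} (i : Fin n) : ℕ := i + 1

/-- The lower-left `k`-quadrant: the dots of `π` in the columns with label less than `k` and the
rows with label at least `k`. -/
def lowerLeft {n : ℕ} (π : Equiv.Perm (Fin n)) (k : ℕ) : Finset (Fin n × Fin n) :=
  {d ∈ dots π | label d.1 < k ∧ k ≤ label d.2}

/-- The upper-right `k`-quadrant: the dots of `π` in the columns with label at least `k` and the
rows with label less than `k`. -/
def upperRight {n : ℕ} (π : Equiv.Perm (Fin n)) (k : ℕ) : Finset (Fin n × Fin n) :=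
  {d ∈ dots π | k ≤ label d.1 ∧ label d.2 < k}

/-- The quadrant condition. -/
def QuadrantCondition {n : ℕ} (π : Equiv.Perm (Fin n)) : Prop :=
  ∀ k ∈ Finset.Icc 2 n, (lowerLeft π k).card = 1 ∧ (upperRight π k).card = 1

end NonAmbiguousTree

/-! The count is controlled by adding leaves one at a time, so trees are studied on arbitrary leaf
sets, in whatever rows and columns these meet (`IsTreeOn`). For n > 0 the CNATs of π are the trees
on `dots π`.

Let v be a new leaf in a fresh row and column. If some leaf lies above and to the right of v, every
tree extends by v and a parent above it; if some leaf lies below and to the left, every tree extends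
by v and a parent to its left. Deleting the row and column of v recovers the old tree. So the count
does not drop in either case, and at least doubles when both kinds of leaf exist. Conversely, if the
upper-right leaves share one row and the lower-left leaves share one column, v can be detached from
any tree, so the count at most doubles, and does not grow if one side is empty.

An empty quadrant excludes all CNATs. Otherwise the missing dots can be added in a suitable order
(`exists_adjacent`), so the count on `dots π` is at least that on any nonempty subset. A quadrant
with two dots gives four leaves carrying three trees, hence a count of 2 forces the quadrant
condition. Under it, the nonfixed dots carry exactly one tree when n > 1 (`ncard_treesOn_le_one` and
monotonicity); one fixed point turns 1 into 2, and a second one gives at least 4. -/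

namespace NonAmbiguousTree

/-! ### Trees on arbitrary leaf sets: roots, attaching and detaching leaves -/

section Trees

variable {c r : ℕ}

/-- `T` is a complete non-ambiguous tree with leaf set `S`, drawn in the subgrid of the columns and
rows that it meets. -/
structure IsTreeOn (T S : Finset (Fin c × Fin r)) : Prop where
  mem_leaves : ∀ d, d ∈ S ↔ d ∈ T ∧ ¬ HasBelow T d ∧ ¬ HasRight T d
  exists_root : ∃ o ∈ T, ∀ d ∈ T, d ≠ o →
    (HasAbove T d ∧ ¬ HasLeft T d) ∨ (¬ HasAbove T d ∧ HasLeft T d)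
  complete : ∀ d ∈ T, (HasBelow T d ∧ HasRight T d) ∨ (¬ HasBelow T d ∧ ¬ HasRight T d)

/-- The trees with leaf set `S`. -/
def treesOn (S : Finset (Fin c × Fin r)) : Set (Finset (Fin c × Fin r)) :=
  {T | IsTreeOn T S}

/-- Reflection in the main diagonal. -/
def transpose (T : Finset (Fin c × Fin r)) : Finset (Fin r × Fin c) :=
  T.map (Equiv.prodComm _ _).toEmbedding

@[simp] lemma mem_transpose {T : Finset (Fin c × Fin r)} {d : Fin r × Fin c} :
    d ∈ transpose T ↔ d.swap ∈ T := by
  simp [transpose, Finset.mem_map_equiv]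

lemma transpose_transpose (T : Finset (Fin c × Fin r)) : transpose (transpose T) = T := by
  ext d; simp

lemma transpose_insert (d : Fin c × Fin r) (T : Finset (Fin c × Fin r)) :
    transpose (insert d T) = insert d.swap (transpose T) := by
  simp [transpose, Finset.map_insert]

lemma hasAbove_transpose {T : Finset (Fin c × Fin r)} {d : Fin r × Fin c} :
    HasAbove (transpose T) d ↔ HasLeft T d.swap := by
  simp [HasAbove, HasLeft]

lemma hasLeft_transpose {T : Finset (Fin c × Fin r)} {d : Fin r × Fin c} :
    HasLeft (transpose T) d ↔ HasAbove T d.swap := by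
  simp [HasAbove, HasLeft]

lemma hasBelow_transpose {T : Finset (Fin c × Fin r)} {d : Fin r × Fin c} :
    HasBelow (transpose T) d ↔ HasRight T d.swap := by
  simp [HasBelow, HasRight]

lemma hasRight_transpose {T : Finset (Fin c × Fin r)} {d : Fin r × Fin c} :
    HasRight (transpose T) d ↔ HasBelow T d.swap := by
  simp [HasBelow, HasRight]

namespace IsTreeOn

variable {T S : Finset (Fin c × Fin r)}

/-- The axioms are symmetric in rows and columns, so every result about a parent above gives one
about a parent to the left. -/
lemma transpose (h : IsTreeOn T S) : IsTreeOn (transpose T) (transpose S) where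
  mem_leaves d := by
    rw [mem_transpose, h.mem_leaves, mem_transpose, hasBelow_transpose, hasRight_transpose]
    tauto
  exists_root := by
    obtain ⟨o, ho, hp⟩ := h.exists_root
    refine ⟨o.swap, by simpa using ho, fun d hd hne => ?_⟩
    have := hp d.swap (by simpa using hd) (fun e => hne (by rw [← e, Prod.swap_swap]))
    rw [hasAbove_transpose, hasLeft_transpose]
    tauto
  complete d hd := by
    have := h.complete d.swap (by simpa using hd)
    rw [hasBelow_transpose, hasRight_transpose]
    tauto

/-- Climbing from a dot along parents. -/
lemma parent_induction {o : Fin c × Fin r} {P : Fin c × Fin r → Prop}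
    (hp : ∀ d ∈ T, d ≠ o → HasAbove T d ∨ HasLeft T d) (h0 : P o)
    (habove : ∀ x y y', y' < y → (x, y) ∈ T → (x, y') ∈ T → P (x, y') → P (x, y))
    (hleft : ∀ x x' y, x' < x → (x, y) ∈ T → (x', y) ∈ T → P (x', y) → P (x, y)) :
    ∀ d ∈ T, P d := by
  -- A parent has a smaller sum of column and row indices.
  suffices H : ∀ m : ℕ, ∀ d ∈ T, (d.1 : ℕ) + d.2 = m → P d from fun d hd => H _ d hd rfl
  intro m
  induction m using Nat.strong_induction_on with
  | _ m ih =>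
    rintro ⟨x, y⟩ hd hm
    by_cases hne : (x, y) = o
    · exact hne ▸ h0
    rcases hp _ hd hne with ⟨y', hlt, hmem⟩ | ⟨x', hlt, hmem⟩
    · refine habove x y y' hlt hd hmem (ih _ ?_ _ hmem rfl)
      simp only [Fin.lt_def] at hlt hm ⊢; omega
    · refine hleft x x' y hlt hd hmem (ih _ ?_ _ hmem rfl)
      simp only [Fin.lt_def] at hlt hm ⊢; omega

lemma root_le {o : Fin c × Fin r} (hp : ∀ d ∈ T, d ≠ o → HasAbove T d ∨ HasLeft T d) :
    ∀ d ∈ T, o.1 ≤ d.1 ∧ o.2 ≤ d.2 :=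
  parent_induction hp ⟨le_rfl, le_rfl⟩
    (fun _ _ _ hlt _ _ ih => ⟨ih.1, ih.2.trans hlt.le⟩)
    (fun _ _ _ hlt _ _ ih => ⟨ih.1.trans hlt.le, ih.2⟩)

/-- The root, which lies weakly above and to the left of every dot. -/
lemma exists_root_le (h : IsTreeOn T S) : ∃ o ∈ T, (∀ d ∈ T, o.1 ≤ d.1 ∧ o.2 ≤ d.2) ∧
    ∀ d ∈ T, d ≠ o → (HasAbove T d ∧ ¬ HasLeft T d) ∨ (¬ HasAbove T d ∧ HasLeft T d) := by
  obtain ⟨o, ho, hp⟩ := h.exists_root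
  exact ⟨o, ho, root_le fun d hd hne => by have := hp d hd hne; tauto, hp⟩

/-- The lowest dot of a column has nothing below it, so by completeness nothing to its right either:
it is a leaf. -/
lemma exists_leaf_column (h : IsTreeOn T S) {x : Fin c} {y : Fin r} (hd : (x, y) ∈ T) :
    ∃ y', y ≤ y' ∧ (x, y') ∈ S := by
  obtain ⟨y', hy', hmax⟩ := (Finset.univ.filter fun z => (x, z) ∈ T ∧ y ≤ z).exists_max_image id
    ⟨y, by simpa using hd⟩
  simp only [Finset.mem_filter, Finset.mem_univ, true_and, id] at hy' hmax
  have hb : ¬ HasBelow T (x, y') := by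
    rintro ⟨z, hz, hzT⟩
    exact absurd (hmax z ⟨hzT, hy'.2.trans hz.le⟩) (not_le.2 hz)
  refine ⟨y', hy'.2, (h.mem_leaves _).2 ⟨hy'.1, hb, ?_⟩⟩
  have := h.complete _ hy'.1
  tauto

lemma exists_leaf_row (h : IsTreeOn T S) {x : Fin c} {y : Fin r} (hd : (x, y) ∈ T) :
    ∃ x', x ≤ x' ∧ (x', y) ∈ S := by
  obtain ⟨x', hx', hm⟩ := h.transpose.exists_leaf_column (x := y) (y := x) (by simpa using hd)
  exact ⟨x', hx', by simpa using hm⟩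

/-- If the root is a leaf, it is the only dot. -/
lemma eq_root {o : Fin c × Fin r} (hp : ∀ d ∈ T, d ≠ o → HasAbove T d ∨ HasLeft T d)
    (hb : ¬ HasBelow T o) (hr : ¬ HasRight T o) : ∀ d ∈ T, d = o :=
  parent_induction hp rfl
    (fun x y y' hlt hd _ ih => absurd ⟨y, by rw [← ih]; exact hlt, by rw [← ih]; exact hd⟩ hb)
    (fun x x' y hlt hd _ ih => absurd ⟨x, by rw [← ih]; exact hlt, by rw [← ih]; exact hd⟩ hr)

/-- From a cell outside the columns of the tree and to the right of the root, a dot above and to the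
right guarantees that a row of the tree is seen when looking up. -/
lemma exists_row_spanning {o : Fin c × Fin r} {x : Fin c} {y : Fin r}
    (hp : ∀ d ∈ T, d ≠ o → HasAbove T d ∨ HasLeft T d)
    (hx : ∀ d ∈ T, d.1 ≠ x) (ho : o.1 < x) :
    ∀ d ∈ T, x < d.1 → d.2 < y →
      ∃ z < y, (∃ l < x, (l, z) ∈ T) ∧ ∃ m, x < m ∧ (m, z) ∈ T := by
  refine parent_induction hp (fun hlt => absurd hlt ho.asymm) ?_ ?_
  · intro a b b' hlt _ _ ih hxa hby
    exact ih hxa (hlt.trans hby)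
  · intro a a' b hlt ha ha' ih hxa hby
    rcases lt_or_gt_of_ne (hx _ ha') with hlt' | hlt'
    · exact ⟨b, hby, ⟨a', hlt', ha'⟩, a, hxa, ha⟩
    · exact ih hlt' hby

/-- A new leaf in a fresh row and column, below a row spanning its column, or in a new first
column. -/
lemma insert_above (h : IsTreeOn T S) {o : Fin c × Fin r} (ho : o ∈ T)
    (hole : ∀ d ∈ T, o.1 ≤ d.1 ∧ o.2 ≤ d.2)
    (hp : ∀ d ∈ T, d ≠ o → (HasAbove T d ∧ ¬ HasLeft T d) ∨ (¬ HasAbove T d ∧ HasLeft T d))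
    {x : Fin c} {y z : Fin r} (hx : ∀ d ∈ T, d.1 ≠ x) (hy : ∀ d ∈ T, d.2 ≠ y) (hz : z < y)
    (hl : (∃ l < x, (l, z) ∈ T) ∨ (x < o.1 ∧ z = o.2)) (hm : ∃ m, x < m ∧ (m, z) ∈ T) :
    IsTreeOn (insert (x, y) (insert (x, z) T)) (insert (x, y) S) := by
  obtain ⟨m, hxm, hm⟩ := hm
  have memT : ∀ a b, (a, b) ∈ insert (x, y) (insert (x, z) T) ↔
      (a = x ∧ b = y) ∨ (a = x ∧ b = z) ∨ (a, b) ∈ T := by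
    intro a b; simp [Finset.mem_insert]
  have hA : ∀ d ∈ T, (HasAbove (insert (x, y) (insert (x, z) T)) d ↔ HasAbove T d) := by
    rintro ⟨a, b⟩ hd
    have := hx _ hd
    simp only [HasAbove, memT]
    grind
  have hB : ∀ d ∈ T, (HasBelow (insert (x, y) (insert (x, z) T)) d ↔ HasBelow T d) := by
    rintro ⟨a, b⟩ hd
    have := hx _ hd
    simp only [HasBelow, memT]
    grind
  have hR : ∀ d ∈ T, (HasRight (insert (x, y) (insert (x, z) T)) d ↔ HasRight T d) := by
    rintro ⟨a, b⟩ hd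
    have := hy _ hd
    simp only [HasRight, memT]
    grind
  have hL : ∀ d ∈ T, (HasLeft (insert (x, y) (insert (x, z) T)) d ↔
      HasLeft T d ∨ (d.2 = z ∧ x < d.1)) := by
    rintro ⟨a, b⟩ hd
    have := hy _ hd
    simp only [HasLeft, memT]
    grind
  have hcol : ∀ b, (x, b) ∉ T := fun b hb => hx _ hb rfl
  have hrow : ∀ a, (a, y) ∉ T := fun a hb => hy _ hb rfl
  have vA : HasAbove (insert (x, y) (insert (x, z) T)) (x, y) := ⟨z, hz, by simp⟩
  have vL : ¬ HasLeft (insert (x, y) (insert (x, z) T)) (x, y) := by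
    simp only [HasLeft, memT]; grind
  have vB : ¬ HasBelow (insert (x, y) (insert (x, z) T)) (x, y) := by
    simp only [HasBelow, memT]; grind
  have vR : ¬ HasRight (insert (x, y) (insert (x, z) T)) (x, y) := by
    simp only [HasRight, memT]; grind
  have dA : ¬ HasAbove (insert (x, y) (insert (x, z) T)) (x, z) := by
    simp only [HasAbove, memT]; grind
  have dB : HasBelow (insert (x, y) (insert (x, z) T)) (x, z) := ⟨y, hz, by simp⟩
  have dR : HasRight (insert (x, y) (insert (x, z) T)) (x, z) := ⟨m, hxm, by simp [hm]⟩
  refine ⟨?_, ?_, ?_⟩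
  · intro d
    rw [Finset.mem_insert, Finset.mem_insert, Finset.mem_insert, h.mem_leaves]
    have h1 : d = (x, z) → d ∉ T := by rintro rfl; exact hcol z
    by_cases hd : d ∈ T
    · rw [hB d hd, hR d hd]
      have : d ≠ (x, y) := by rintro rfl; exact hcol y hd
      tauto
    · by_cases h2 : d = (x, y)
      · subst h2; tauto
      · by_cases h3 : d = (x, z)
        · subst h3; tauto
        · tauto
  -- Either the old root survives and (x, z) hangs from its left, or (x, z) lies left of the old
  -- root in its row and becomes the new root.
  · rcases hl with ⟨l, hlx, hl⟩ | ⟨hxo, rfl⟩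
    · have dL : HasLeft (insert (x, y) (insert (x, z) T)) (x, z) := ⟨l, hlx, by simp [hl]⟩
      refine ⟨o, by simp [ho], fun d hd hne => ?_⟩
      rw [Finset.mem_insert, Finset.mem_insert] at hd
      rcases hd with rfl | rfl | hd
      · tauto
      · tauto
      · have := hp d hd hne
        -- The new dot (x, z) is a left neighbour only of dots that already had one, so no dot gains
        -- a second parent.
        have key : d.2 = z ∧ x < d.1 → HasLeft T d := by
          rintro ⟨e, hlt⟩
          exact ⟨l, hlx.trans hlt, e ▸ hl⟩
        rw [hA d hd, hL d hd]
        tauto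
    · refine ⟨(x, o.2), by simp, fun d hd hne => ?_⟩
      rw [Finset.mem_insert, Finset.mem_insert] at hd
      rcases hd with rfl | rfl | hd
      · tauto
      · tauto
      · rw [hA d hd, hL d hd]
        by_cases hdo : d = o
        · subst hdo
          have : ¬ HasAbove T d := by
            rintro ⟨b, hb, hbT⟩
            exact absurd (hole _ hbT).2 (not_le.2 hb)
          tauto
        · have := hp d hd hdo
          have key : d.2 = o.2 ∧ x < d.1 → HasLeft T d := by
            rintro ⟨e, _⟩
            refine ⟨o.1, lt_of_le_of_ne (hole d hd).1 fun e' => hdo (Prod.ext e'.symm e), ?_⟩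
            rw [e]; exact ho
          tauto
  · intro d hd
    rw [Finset.mem_insert, Finset.mem_insert] at hd
    rcases hd with rfl | rfl | hd
    · tauto
    · tauto
    · rw [hB d hd, hR d hd]
      exact h.complete d hd

lemma fst_ne (h : IsTreeOn T S) {x : Fin c} (hx : ∀ s ∈ S, s.1 ≠ x) : ∀ d ∈ T, d.1 ≠ x := by
  rintro ⟨a, b⟩ hd
  obtain ⟨b', -, hb'⟩ := h.exists_leaf_column hd
  exact fun e => hx _ hb' e

lemma snd_ne (h : IsTreeOn T S) {y : Fin r} (hy : ∀ s ∈ S, s.2 ≠ y) : ∀ d ∈ T, d.2 ≠ y := by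
  rintro ⟨a, b⟩ hd
  obtain ⟨a', -, ha'⟩ := h.exists_leaf_row hd
  exact fun e => hy _ ha' e

lemma leaves_subset (h : IsTreeOn T S) : S ⊆ T := fun d hd => ((h.mem_leaves d).1 hd).1

/-- A fresh leaf with a leaf above it to the right can be attached by a dot in its column. -/
lemma exists_insert_above (h : IsTreeOn T S) {x : Fin c} {y : Fin r} (hx : ∀ s ∈ S, s.1 ≠ x)
    (hy : ∀ s ∈ S, s.2 ≠ y) (hq : ∃ q ∈ S, x < q.1 ∧ q.2 < y) :
    ∃ z < y, IsTreeOn (insert (x, y) (insert (x, z) T)) (insert (x, y) S) := by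
  obtain ⟨o, ho, hole, hp⟩ := h.exists_root_le
  obtain ⟨q, hqS, hqx, hqy⟩ := hq
  have hqT := h.leaves_subset hqS
  rcases lt_or_gt_of_ne (h.fst_ne hx o ho) with hox | hox
  · obtain ⟨z, hz, hl, hm⟩ := exists_row_spanning (fun d hd hne => by have := hp d hd hne; tauto)
      (h.fst_ne hx) hox q hqT hqx hqy
    exact ⟨z, hz, h.insert_above ho hole hp (h.fst_ne hx) (h.snd_ne hy) hz (.inl hl) hm⟩
  · have hz : o.2 < y := (hole q hqT).2.trans_lt hqy
    exact ⟨o.2, hz, h.insert_above ho hole hp (h.fst_ne hx) (h.snd_ne hy) hz (.inr ⟨hox, rfl⟩)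
      ⟨o.1, hox, ho⟩⟩

/-- A fresh leaf with a leaf below it to the left can be attached by a dot in its row. -/
lemma exists_insert_left (h : IsTreeOn T S) {x : Fin c} {y : Fin r} (hx : ∀ s ∈ S, s.1 ≠ x)
    (hy : ∀ s ∈ S, s.2 ≠ y) (hq : ∃ q ∈ S, q.1 < x ∧ y < q.2) :
    ∃ z < x, IsTreeOn (insert (x, y) (insert (z, y) T)) (insert (x, y) S) := by
  obtain ⟨z, hz, hT⟩ := h.transpose.exists_insert_above (x := y) (y := x)
    (fun s hs => hy s.swap (by simpa using hs)) (fun s hs => hx s.swap (by simpa using hs))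
    (by obtain ⟨q, hq, h1, h2⟩ := hq; exact ⟨q.swap, by simpa using hq, h2, h1⟩)
  refine ⟨z, hz, ?_⟩
  have := hT.transpose
  simpa [transpose_insert, transpose_transpose] using this

/-- Detaching a leaf whose parent lies above it, when that is the only dot above it. -/
lemma sdiff_above {x : Fin c} {y z : Fin r} (h : IsTreeOn T (insert (x, y) S))
    (hx : ∀ s ∈ S, s.1 ≠ x) (hy : ∀ s ∈ S, s.2 ≠ y)
    (hz : ∀ q ∈ S, x < q.1 → q.2 < y → q.2 = z) (hab : HasAbove T (x, y)) :
    ∃ T', IsTreeOn T' S ∧ insert (x, y) (insert (x, z) T') = T := by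
  obtain ⟨o, ho, hole, hp⟩ := h.exists_root_le
  obtain ⟨hvT, vB, vR⟩ := (h.mem_leaves (x, y)).1 (by simp)
  have hvo : (x, y) ≠ o := by
    rintro rfl
    obtain ⟨b, hb, hbT⟩ := hab
    exact absurd (hole _ hbT).2 (not_le.2 hb)
  have vL : ¬ HasLeft T (x, y) := by have := hp _ hvT hvo; tauto
  have hrow : ∀ a, (a, y) ∈ T → a = x := by
    intro a ha
    rcases lt_trichotomy a x with h1 | h1 | h1
    · exact absurd ⟨a, h1, ha⟩ vL
    · exact h1
    · exact absurd ⟨a, h1, ha⟩ vR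
  -- The row of any other dot of column x ends in a leaf to the upper right of (x, y), so that row
  -- is z. Hence column x consists of (x, y) and (x, z) only.
  have hcol' : ∀ b, (x, b) ∈ T → b ≠ y → b < y ∧ b = z ∧ ∃ m, x < m ∧ (m, b) ∈ S := by
    intro b hb hne
    have hlt : b < y := lt_of_le_of_ne (not_lt.1 fun hlt => vB ⟨b, hlt, hb⟩) hne
    obtain ⟨m, hm, hmS⟩ := h.exists_leaf_row hb
    have hmS' : (m, b) ∈ S := by
      rcases Finset.mem_insert.1 hmS with e | e
      · exact absurd (Prod.ext_iff.1 e).2 hne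
      · exact e
    have hxm : x < m := lt_of_le_of_ne hm fun e => hx _ hmS' e.symm
    exact ⟨hlt, hz _ hmS' hxm hlt, m, hxm, hmS'⟩
  obtain ⟨b, hb, hbT⟩ := hab
  obtain ⟨-, rfl, m, hxm, hmS⟩ := hcol' b hbT hb.ne
  have hcol : ∀ e, (x, e) ∈ T → e = y ∨ e = b := fun e he =>
    or_iff_not_imp_left.2 fun hne => (hcol' e he hne).2.1
  have hmT : (m, b) ∈ T := h.leaves_subset (Finset.mem_insert_of_mem hmS)
  have hby : b ≠ y := hb.ne
  set T' := (T.erase (x, y)).erase (x, b) with hT'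
  have memT : ∀ d, d ∈ T' ↔ d ≠ (x, b) ∧ d ≠ (x, y) ∧ d ∈ T := by
    intro d; simp [hT']
  have memT2 : ∀ a e, (a, e) ∈ T' ↔ a ≠ x ∧ (a, e) ∈ T := by
    intro a e
    simp only [memT, ne_eq, Prod.mk.injEq]
    constructor
    · rintro ⟨h1, h2, h3⟩
      refine ⟨?_, h3⟩
      rintro rfl
      have := hcol e h3
      tauto
    · tauto
  have hne : ∀ d ∈ T', d.1 ≠ x := fun d hd => ((memT2 d.1 d.2).1 hd).1
  have hne2 : ∀ d ∈ T', d.2 ≠ y := fun d hd e => hne d hd (hrow _ (by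
    rw [← e]; exact ((memT2 d.1 d.2).1 hd).2))
  have hmT' : (m, b) ∈ T' := (memT2 _ _).2 ⟨hxm.ne', hmT⟩
  have hA : ∀ d ∈ T', (HasAbove T' d ↔ HasAbove T d) := by
    rintro ⟨a, e⟩ hd
    have := hne _ hd
    simp only [HasAbove, memT2]
    grind
  have hB : ∀ d ∈ T', (HasBelow T' d ↔ HasBelow T d) := by
    rintro ⟨a, e⟩ hd
    have := hne _ hd
    simp only [HasBelow, memT2]
    grind
  have hR : ∀ d ∈ T', (HasRight T' d ↔ HasRight T d) := by
    rintro ⟨a, e⟩ hd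
    have := hne2 _ hd
    simp only [HasRight, memT2]
    constructor
    · rintro ⟨w, h1, h2, h3⟩; exact ⟨w, h1, h3⟩
    · rintro ⟨w, h1, h3⟩
      by_cases hw : w = x
      · subst hw
        rcases hcol _ h3 with rfl | rfl
        · exact absurd rfl this
        -- Where (x, b) was the dot to the right, the leaf (m, b) replaces it.
        · exact ⟨m, h1.trans hxm, hxm.ne', hmT⟩
      · exact ⟨w, h1, hw, h3⟩
  have hL : ∀ d ∈ T', HasLeft T d → HasLeft T' d ∨ (d.2 = b ∧ x < d.1) := by
    rintro ⟨a, e⟩ hd ⟨w, h1, h3⟩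
    by_cases hw : w = x
    · subst hw
      rcases hcol _ h3 with rfl | rfl
      · exact absurd rfl (hne2 _ hd)
      · exact .inr ⟨rfl, h1⟩
    · exact .inl ⟨w, h1, (memT2 _ _).2 ⟨hw, h3⟩⟩
  have hL' : ∀ d, HasLeft T' d → HasLeft T d := by
    rintro d ⟨w, h1, h3⟩
    exact ⟨w, h1, ((memT2 _ _).1 h3).2⟩
  refine ⟨T', ⟨?_, ?_, ?_⟩, ?_⟩
  · intro d
    by_cases hd : d ∈ T'
    · rw [hB d hd, hR d hd]
      have := h.mem_leaves d
      have h1 := hne d hd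
      have h2 : d ≠ (x, y) := by rintro rfl; exact h1 rfl
      have h3 := ((memT d).1 hd).2.2
      rw [Finset.mem_insert] at this
      tauto
    · refine iff_of_false (fun hdS => hd ?_) (fun hh => hd hh.1)
      exact (memT2 d.1 d.2).2 ⟨hx d hdS, h.leaves_subset (Finset.mem_insert_of_mem hdS)⟩
  -- If the deleted parent was the root, the leftmost remaining dot of its row takes over. Otherwise
  -- that parent has a dot to its left, which serves as left neighbour for the dots that had (x, b).
  · by_cases hbo : (x, b) = o
    · obtain ⟨l, hl, hmin⟩ := (Finset.univ.filter fun a => (a, b) ∈ T').exists_min_image id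
        ⟨m, by simpa using hmT'⟩
      simp only [Finset.mem_filter, Finset.mem_univ, true_and, id] at hl hmin
      refine ⟨(l, b), hl, fun d hd hdl => ?_⟩
      rw [hA d hd]
      have hdT := ((memT d).1 hd)
      have h1 := hp d hdT.2.2 (hbo ▸ hdT.1)
      have h2 := hL d hd
      have h3 := hL' d
      have h4 : d.2 = b → HasLeft T' d := fun e => by
        have hdb : (d.1, b) ∈ T' := e ▸ hd
        exact ⟨l, lt_of_le_of_ne (hmin _ hdb) fun e' => hdl (Prod.ext e'.symm e), e ▸ hl⟩
      tauto
    · have hLb : HasLeft T' (x, b) := by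
        have h1 := hp _ hbT hbo
        have h2 : ¬ HasAbove T (x, b) := by
          rintro ⟨e, he, heT⟩
          rcases hcol e heT with rfl | rfl
          · exact absurd he hb.asymm
          · exact lt_irrefl _ he
        obtain ⟨w, hw, hwT⟩ : HasLeft T (x, b) := by tauto
        exact ⟨w, hw, (memT2 _ _).2 ⟨hw.ne, hwT⟩⟩
      obtain ⟨w, hw, hwT⟩ := hLb
      refine ⟨o, ?_, fun d hd hdo => ?_⟩
      · rw [memT]; exact ⟨Ne.symm hbo, Ne.symm hvo, ho⟩
      · rw [hA d hd]
        have h1 := hp d ((memT d).1 hd).2.2 hdo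
        have h2 := hL d hd
        have h3 := hL' d
        have h4 : d.2 = b ∧ x < d.1 → HasLeft T' d := by
          rintro ⟨e, hlt⟩
          exact ⟨w, hw.trans hlt, e ▸ hwT⟩
        tauto
  · intro d hd
    rw [hB d hd, hR d hd]
    exact h.complete d ((memT d).1 hd).2.2
  · ext d
    rw [Finset.mem_insert, Finset.mem_insert, memT]
    constructor
    · rintro (rfl | rfl | hd)
      exacts [hvT, hbT, hd.2.2]
    · tauto

/-- Detaching a leaf whose parent lies to its left, when that is the only dot to its left. -/
lemma sdiff_left {x z : Fin c} {y : Fin r} (h : IsTreeOn T (insert (x, y) S))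
    (hx : ∀ s ∈ S, s.1 ≠ x) (hy : ∀ s ∈ S, s.2 ≠ y)
    (hz : ∀ q ∈ S, q.1 < x → y < q.2 → q.1 = z) (hab : HasLeft T (x, y)) :
    ∃ T', IsTreeOn T' S ∧ insert (x, y) (insert (z, y) T') = T := by
  have h' := h.transpose
  rw [transpose_insert] at h'
  obtain ⟨T', hT', e⟩ := h'.sdiff_above (z := z)
    (fun s hs => hy s.swap (by simpa using hs)) (fun s hs => hx s.swap (by simpa using hs))
    (fun q hq h1 h2 => hz q.swap (by simpa using hq) h2 h1) (hasAbove_transpose.2 hab)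
  refine ⟨_, by simpa [transpose_transpose] using hT'.transpose, ?_⟩
  have := congrArg NonAmbiguousTree.transpose e
  simpa [transpose_insert, transpose_transpose] using this

/-- The row of a dot above (x, y) ends in a leaf weakly to its right; freshness of column x makes
this strict. -/
lemma exists_upper_right {x : Fin c} {y : Fin r} (h : IsTreeOn T (insert (x, y) S))
    (hx : ∀ s ∈ S, s.1 ≠ x) (hab : HasAbove T (x, y)) : ∃ q ∈ S, x < q.1 ∧ q.2 < y := by
  obtain ⟨b, hb, hbT⟩ := hab
  obtain ⟨m, hm, hmS⟩ := h.exists_leaf_row hbT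
  rcases Finset.mem_insert.1 hmS with e | e
  · exact absurd (Prod.ext_iff.1 e).2 hb.ne
  · exact ⟨_, e, lt_of_le_of_ne hm fun e' => hx _ e e'.symm, hb⟩

lemma exists_lower_left {x : Fin c} {y : Fin r} (h : IsTreeOn T (insert (x, y) S))
    (hy : ∀ s ∈ S, s.2 ≠ y) (hab : HasLeft T (x, y)) : ∃ q ∈ S, q.1 < x ∧ y < q.2 := by
  obtain ⟨b, hb, hbT⟩ := hab
  obtain ⟨m, hm, hmS⟩ := h.exists_leaf_column hbT
  rcases Finset.mem_insert.1 hmS with e | e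
  · exact absurd (Prod.ext_iff.1 e).1 hb.ne
  · exact ⟨_, e, hb, lt_of_le_of_ne hm fun e' => hy _ e e'.symm⟩

lemma hasAbove_or_hasLeft {v : Fin c × Fin r} (h : IsTreeOn T (insert v S)) (hS : ∃ s ∈ S, s ≠ v) :
    HasAbove T v ∨ HasLeft T v := by
  obtain ⟨o, ho, hp⟩ := h.exists_root
  obtain ⟨hvT, vB, vR⟩ := (h.mem_leaves v).1 (by simp)
  by_cases hvo : v = o
  · subst hvo
    obtain ⟨s, hs, hne⟩ := hS
    exact absurd (eq_root (fun d hd hne => by have := hp d hd hne; tauto) vB vR s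
      (h.leaves_subset (Finset.mem_insert_of_mem hs))) hne
  · have := hp v hvT hvo
    tauto

end IsTreeOn

/-- The dots outside the column `x` and the row `y`. -/
def restrict (x : Fin c) (y : Fin r) (T : Finset (Fin c × Fin r)) : Finset (Fin c × Fin r) :=
  T.filter fun d => d.1 ≠ x ∧ d.2 ≠ y

lemma restrict_insert_insert {T : Finset (Fin c × Fin r)} {x : Fin c} {y : Fin r}
    (hx : ∀ d ∈ T, d.1 ≠ x) (hy : ∀ d ∈ T, d.2 ≠ y) (v w : Fin c × Fin r)
    (hv : v.1 = x ∨ v.2 = y) (hw : w.1 = x ∨ w.2 = y) :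
    restrict x y (insert v (insert w T)) = T := by
  ext d
  simp only [restrict, Finset.mem_filter, Finset.mem_insert]
  grind

/-! ### Effect of a new leaf on the number of trees -/

section Counting

variable {S : Finset (Fin c × Fin r)} {x : Fin c} {y : Fin r}

/-- The row z of the added parent depends on the tree; phrasing injectivity as an image under
`restrict` avoids having to choose it. -/
lemma treesOn_subset_image_above (hx : ∀ s ∈ S, s.1 ≠ x) (hy : ∀ s ∈ S, s.2 ≠ y)
    (hq : ∃ q ∈ S, x < q.1 ∧ q.2 < y) :
    treesOn S ⊆ restrict x y '' (treesOn (insert (x, y) S) ∩ {T | HasAbove T (x, y)}) := by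
  intro T hT
  obtain ⟨z, hz, h⟩ := IsTreeOn.exists_insert_above hT hx hy hq
  exact ⟨_, ⟨h, ⟨z, hz, by simp⟩⟩, restrict_insert_insert (IsTreeOn.fst_ne hT hx)
    (IsTreeOn.snd_ne hT hy) _ _ (.inl rfl) (.inl rfl)⟩

lemma treesOn_subset_image_left (hx : ∀ s ∈ S, s.1 ≠ x) (hy : ∀ s ∈ S, s.2 ≠ y)
    (hq : ∃ q ∈ S, q.1 < x ∧ y < q.2) :
    treesOn S ⊆ restrict x y '' (treesOn (insert (x, y) S) \ {T | HasAbove T (x, y)}) := by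
  intro T hT
  obtain ⟨z, hz, h⟩ := IsTreeOn.exists_insert_left hT hx hy hq
  refine ⟨_, ⟨h, ?_⟩, restrict_insert_insert (IsTreeOn.fst_ne hT hx)
    (IsTreeOn.snd_ne hT hy) _ _ (.inl rfl) (.inr rfl)⟩
  rintro ⟨b, hb, hbT⟩
  simp only [Finset.mem_insert, Prod.mk.injEq, true_and] at hbT
  rcases hbT with e | ⟨-, e⟩ | hbT
  · exact hb.ne e
  · exact hb.ne e
  · exact IsTreeOn.fst_ne hT hx _ hbT rfl

lemma ncard_treesOn_insert_ge (hx : ∀ s ∈ S, s.1 ≠ x) (hy : ∀ s ∈ S, s.2 ≠ y)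
    (hq : (∃ q ∈ S, x < q.1 ∧ q.2 < y) ∨ ∃ q ∈ S, q.1 < x ∧ y < q.2) :
    (treesOn S).ncard ≤ (treesOn (insert (x, y) S)).ncard := by
  rcases hq with hq | hq
  · exact (Set.ncard_le_ncard (treesOn_subset_image_above hx hy hq) (Set.toFinite _)).trans
      ((Set.ncard_image_le (Set.toFinite _)).trans
        (Set.ncard_le_ncard Set.inter_subset_left (Set.toFinite _)))
  · exact (Set.ncard_le_ncard (treesOn_subset_image_left hx hy hq) (Set.toFinite _)).trans
      ((Set.ncard_image_le (Set.toFinite _)).trans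
        (Set.ncard_le_ncard Set.sdiff_subset (Set.toFinite _)))

/-- Extensions with a dot above the new leaf and extensions without one are disjoint families, each
at least as large as `treesOn S`. -/
lemma two_mul_ncard_treesOn_le_insert (hx : ∀ s ∈ S, s.1 ≠ x) (hy : ∀ s ∈ S, s.2 ≠ y)
    (hq : ∃ q ∈ S, x < q.1 ∧ q.2 < y) (hq' : ∃ q ∈ S, q.1 < x ∧ y < q.2) :
    2 * (treesOn S).ncard ≤ (treesOn (insert (x, y) S)).ncard := by
  have h1 := (Set.ncard_le_ncard (treesOn_subset_image_above hx hy hq) (Set.toFinite _)).trans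
    (Set.ncard_image_le (Set.toFinite _))
  have h2 := (Set.ncard_le_ncard (treesOn_subset_image_left hx hy hq') (Set.toFinite _)).trans
    (Set.ncard_image_le (Set.toFinite _))
  have h3 := Set.ncard_inter_add_ncard_sdiff_eq_ncard (treesOn (insert (x, y) S))
    {T | HasAbove T (x, y)} (Set.toFinite _)
  omega

/-- The trees on `insert (x, y) S` when the dots above or to the left of `(x, y)` can only lie in
the row `z` and the column `w`. -/
lemma treesOn_insert_subset {w : Fin c} {z : Fin r} (hS : S.Nonempty) (hx : ∀ s ∈ S, s.1 ≠ x)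
    (hy : ∀ s ∈ S, s.2 ≠ y) (hz : ∀ q ∈ S, x < q.1 → q.2 < y → q.2 = z)
    (hw : ∀ q ∈ S, q.1 < x → y < q.2 → q.1 = w) :
    treesOn (insert (x, y) S) ⊆ (fun T => insert (x, y) (insert (x, z) T)) '' treesOn S ∪
      (fun T => insert (x, y) (insert (w, y) T)) '' treesOn S := by
  intro T hT
  obtain ⟨s, hs⟩ := hS
  rcases IsTreeOn.hasAbove_or_hasLeft hT ⟨s, hs, fun e => hx s hs (by rw [e])⟩ with hab | hab
  · exact .inl (IsTreeOn.sdiff_above hT hx hy hz hab)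
  · exact .inr (IsTreeOn.sdiff_left hT hx hy hw hab)

lemma ncard_treesOn_insert_le_two_mul {w : Fin c} {z : Fin r} (hS : S.Nonempty)
    (hx : ∀ s ∈ S, s.1 ≠ x) (hy : ∀ s ∈ S, s.2 ≠ y)
    (hz : ∀ q ∈ S, x < q.1 → q.2 < y → q.2 = z) (hw : ∀ q ∈ S, q.1 < x → y < q.2 → q.1 = w) :
    (treesOn (insert (x, y) S)).ncard ≤ 2 * (treesOn S).ncard := by
  have h1 := Set.ncard_le_ncard (treesOn_insert_subset hS hx hy hz hw) (Set.toFinite _)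
  have h2 := Set.ncard_image_le (f := fun T => insert (x, y) (insert (x, z) T))
    (Set.toFinite (treesOn S))
  have h3 := Set.ncard_image_le (f := fun T => insert (x, y) (insert (w, y) T))
    (Set.toFinite (treesOn S))
  have h4 := Set.ncard_union_le ((fun T => insert (x, y) (insert (x, z) T)) '' treesOn S)
    ((fun T => insert (x, y) (insert (w, y) T)) '' treesOn S)
  omega

lemma ncard_treesOn_insert_le_above {z : Fin r} (hS : S.Nonempty)
    (hx : ∀ s ∈ S, s.1 ≠ x) (hy : ∀ s ∈ S, s.2 ≠ y)
    (hz : ∀ q ∈ S, x < q.1 → q.2 < y → q.2 = z) (hw : ∀ q ∈ S, q.1 < x → q.2 ≤ y) :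
    (treesOn (insert (x, y) S)).ncard ≤ (treesOn S).ncard := by
  refine (Set.ncard_le_ncard (t := (fun T => insert (x, y) (insert (x, z) T)) '' treesOn S) ?_
    (Set.toFinite _)).trans (Set.ncard_image_le (Set.toFinite _))
  intro T hT
  obtain ⟨s, hs⟩ := hS
  rcases IsTreeOn.hasAbove_or_hasLeft hT ⟨s, hs, fun e => hx s hs (by rw [e])⟩ with hab | hab
  · exact IsTreeOn.sdiff_above hT hx hy hz hab
  · obtain ⟨q, hq, h1, h2⟩ := IsTreeOn.exists_lower_left hT hy hab
    exact absurd (hw q hq h1) (not_le.2 h2)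

lemma ncard_treesOn_insert_le_left {w : Fin c} (hS : S.Nonempty)
    (hx : ∀ s ∈ S, s.1 ≠ x) (hy : ∀ s ∈ S, s.2 ≠ y)
    (hz : ∀ q ∈ S, x < q.1 → y ≤ q.2) (hw : ∀ q ∈ S, q.1 < x → y < q.2 → q.1 = w) :
    (treesOn (insert (x, y) S)).ncard ≤ (treesOn S).ncard := by
  refine (Set.ncard_le_ncard (t := (fun T => insert (x, y) (insert (w, y) T)) '' treesOn S) ?_
    (Set.toFinite _)).trans (Set.ncard_image_le (Set.toFinite _))
  intro T hT
  obtain ⟨s, hs⟩ := hS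
  rcases IsTreeOn.hasAbove_or_hasLeft hT ⟨s, hs, fun e => hx s hs (by rw [e])⟩ with hab | hab
  · obtain ⟨q, hq, h1, h2⟩ := IsTreeOn.exists_upper_right hT hx hab
    exact absurd (hz q hq h1) (not_le.2 h2)
  · exact IsTreeOn.sdiff_left hT hx hy hw hab

end Counting

/-! ### Trees with few leaves -/

lemma treesOn_empty : treesOn (∅ : Finset (Fin c × Fin r)) = ∅ := by
  refine Set.eq_empty_of_forall_notMem fun T (hT : IsTreeOn T ∅) => ?_
  obtain ⟨⟨a, b⟩, ho, -⟩ := hT.exists_root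
  obtain ⟨b', -, hb⟩ := hT.exists_leaf_column ho
  simp at hb

lemma treesOn_singleton (v : Fin c × Fin r) : treesOn {v} = {{v}} := by
  obtain ⟨x, y⟩ := v
  ext T
  constructor
  · intro (hT : IsTreeOn T {(x, y)})
    refine Finset.Subset.antisymm ?_ hT.leaves_subset
    rintro ⟨a, b⟩ hd
    obtain ⟨b', -, h1⟩ := hT.exists_leaf_column hd
    obtain ⟨a', -, h2⟩ := hT.exists_leaf_row hd
    simp_all
  · rintro rfl
    have hB : ¬ HasBelow {(x, y)} (x, y) := by simp [HasBelow]
    have hR : ¬ HasRight {(x, y)} (x, y) := by simp [HasRight]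
    refine ⟨?_, ⟨(x, y), by simp⟩, by simp [hB, hR]⟩
    intro d
    rw [Finset.mem_singleton]
    constructor
    · rintro rfl; exact ⟨rfl, hB, hR⟩
    · exact fun h => h.1

/-- This and the next two are binary trees with root (a, C) and three internal dots: here both
children of the root are internal; then only the lower one, (a, D); then only the right one, (b, C).
-/
lemma isTreeOn_fork {a b e f : Fin c} {A B C D : Fin r} (hab : a < b) (hbe : b < e)
    (hbf : b < f) (hef : e ≠ f) (hCD : C < D) (hDA : D < A) (hDB : D < B) (hAB : A ≠ B) :
    IsTreeOn {(a, A), (b, B), (e, C), (f, D), (a, C), (a, D), (b, C)}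
      {(a, A), (b, B), (e, C), (f, D)} := by
  refine ⟨?_, ⟨(a, C), by simp, ?_⟩, ?_⟩
  · rintro ⟨x, y⟩
    simp only [HasBelow, HasRight, Finset.mem_insert, Finset.mem_singleton, Prod.mk.injEq]
    constructor
    · grind (splits := 30)
    · rintro ⟨h1, h2, -⟩
      rcases h1 with h1 | h1 | h1 | h1 | h1 | h1 | h1
      iterate 4 grind (splits := 30)
      · exact absurd ⟨A, by grind⟩ h2
      · exact absurd ⟨A, by grind⟩ h2
      · exact absurd ⟨B, by grind⟩ h2
  · rintro ⟨x, y⟩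
    simp only [HasAbove, HasLeft, Finset.mem_insert, Finset.mem_singleton, Prod.mk.injEq]
    grind (splits := 40)
  · rintro ⟨x, y⟩
    simp only [HasBelow, HasRight, Finset.mem_insert, Finset.mem_singleton, Prod.mk.injEq]
    grind (splits := 40)

lemma isTreeOn_column {a b e f : Fin c} {A B C D : Fin r} (hab : a < b) (hbe : b < e)
    (hbf : b < f) (hef : e ≠ f) (hCD : C < D) (hDA : D < A) (hDB : D < B) (hAB : A ≠ B) :
    IsTreeOn {(a, A), (b, B), (e, C), (f, D), (a, C), (a, D), (b, D)}
      {(a, A), (b, B), (e, C), (f, D)} := by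
  refine ⟨?_, ⟨(a, C), by simp, ?_⟩, ?_⟩
  · rintro ⟨x, y⟩
    simp only [HasBelow, HasRight, Finset.mem_insert, Finset.mem_singleton, Prod.mk.injEq]
    constructor
    · grind (splits := 30)
    · rintro ⟨h1, h2, -⟩
      rcases h1 with h1 | h1 | h1 | h1 | h1 | h1 | h1
      iterate 4 grind (splits := 30)
      · exact absurd ⟨A, by grind⟩ h2
      · exact absurd ⟨A, by grind⟩ h2
      · exact absurd ⟨B, by grind⟩ h2
  · rintro ⟨x, y⟩
    simp only [HasAbove, HasLeft, Finset.mem_insert, Finset.mem_singleton, Prod.mk.injEq]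
    grind (splits := 40)
  · rintro ⟨x, y⟩
    simp only [HasBelow, HasRight, Finset.mem_insert, Finset.mem_singleton, Prod.mk.injEq]
    grind (splits := 40)

lemma isTreeOn_row {a b e f : Fin c} {A B C D : Fin r} (hab : a < b) (hbe : b < e)
    (hbf : b < f) (hef : e ≠ f) (hCD : C < D) (hDA : D < A) (hDB : D < B) (hAB : A ≠ B) :
    IsTreeOn {(a, A), (b, B), (e, C), (f, D), (a, C), (b, C), (b, D)}
      {(a, A), (b, B), (e, C), (f, D)} := by
  refine ⟨?_, ⟨(a, C), by simp, ?_⟩, ?_⟩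
  · rintro ⟨x, y⟩
    simp only [HasBelow, HasRight, Finset.mem_insert, Finset.mem_singleton, Prod.mk.injEq]
    constructor
    · grind (splits := 30)
    · rintro ⟨h1, h2, -⟩
      rcases h1 with h1 | h1 | h1 | h1 | h1 | h1 | h1
      iterate 4 grind (splits := 30)
      · exact absurd ⟨A, by grind⟩ h2
      · exact absurd ⟨B, by grind⟩ h2
      · exact absurd ⟨B, by grind⟩ h2
  · rintro ⟨x, y⟩
    simp only [HasAbove, HasLeft, Finset.mem_insert, Finset.mem_singleton, Prod.mk.injEq]
    grind (splits := 40)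
  · rintro ⟨x, y⟩
    simp only [HasBelow, HasRight, Finset.mem_insert, Finset.mem_singleton, Prod.mk.injEq]
    grind (splits := 40)

/-- Two dots in a lower-left quadrant and two dots in the corresponding upper-right quadrant are the
leaves of at least three trees. -/
lemma three_le_ncard_treesOn {a b e f : Fin c} {A B C D : Fin r} (hab : a < b) (hbe : b < e)
    (hbf : b < f) (hef : e ≠ f) (hCD : C < D) (hDA : D < A) (hDB : D < B) (hAB : A ≠ B) :
    3 ≤ (treesOn {(a, A), (b, B), (e, C), (f, D)}).ncard := by
  have h1 := isTreeOn_fork hab hbe hbf hef hCD hDA hDB hAB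
  have h2 := isTreeOn_column hab hbe hbf hef hCD hDA hDB hAB
  have h3 := isTreeOn_row hab hbe hbf hef hCD hDA hDB hAB
  refine (Set.two_lt_ncard (Set.toFinite _)).2 ⟨_, h1, _, h2, _, h3, ?_, ?_, ?_⟩
  · intro h
    have := congrArg (fun T => (b, C) ∈ T) h
    simp only [Finset.mem_insert, Finset.mem_singleton, Prod.mk.injEq] at this
    grind
  · intro h
    have := congrArg (fun T => (a, D) ∈ T) h
    simp only [Finset.mem_insert, Finset.mem_singleton, Prod.mk.injEq] at this
    grind
  · intro h
    have := congrArg (fun T => (a, D) ∈ T) h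
    simp only [Finset.mem_insert, Finset.mem_singleton, Prod.mk.injEq] at this
    grind

end Trees

section Permutations

variable {n : ℕ} {π : Equiv.Perm (Fin n)}

@[simp] lemma mem_dots {d : Fin n × Fin n} : d ∈ dots π ↔ π d.1 = d.2 := by
  obtain ⟨a, b⟩ := d
  simp [dots]

lemma fst_ne_of_notMem {S : Finset (Fin n × Fin n)} {v : Fin n × Fin n} (hS : S ⊆ dots π)
    (hv : v ∈ dots π) (hvS : v ∉ S) : ∀ s ∈ S, s.1 ≠ v.1 := by
  intro s hs e
  have h1 := mem_dots.1 (hS hs)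
  rw [e, mem_dots.1 hv] at h1
  exact hvS (Prod.ext e h1.symm ▸ hs)

lemma snd_ne_of_notMem {S : Finset (Fin n × Fin n)} {v : Fin n × Fin n} (hS : S ⊆ dots π)
    (hv : v ∈ dots π) (hvS : v ∉ S) : ∀ s ∈ S, s.2 ≠ v.2 := by
  intro s hs e
  have h1 := mem_dots.1 (hS hs)
  rw [e, ← mem_dots.1 hv] at h1
  exact fst_ne_of_notMem hS hv hvS s hs (π.injective h1)

/-! ### Quadrants of a permutation -/

section Quadrants

lemma card_lowerLeft (π : Equiv.Perm (Fin n)) (k : Fin n) :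
    (lowerLeft π (k + 1)).card = (Finset.univ.filter fun i => i < k ∧ k ≤ π i).card := by
  have : lowerLeft π (k + 1) =
      (Finset.univ.filter fun i => i < k ∧ k ≤ π i).image fun i => (i, π i) := by
    ext ⟨a, b⟩
    rw [lowerLeft, Finset.mem_filter, mem_dots, Finset.mem_image]
    simp only [Finset.mem_filter, Finset.mem_univ, true_and, Prod.mk.injEq, label, Fin.lt_def,
      Fin.le_def]
    constructor
    · rintro ⟨rfl, h⟩
      exact ⟨a, by omega, rfl, rfl⟩
    · rintro ⟨i, h, rfl, rfl⟩
      exact ⟨rfl, by omega⟩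
  rw [this, Finset.card_image_of_injective _ fun a b h => (Prod.ext_iff.1 h).1]

lemma card_upperRight (π : Equiv.Perm (Fin n)) (k : Fin n) :
    (upperRight π (k + 1)).card = (Finset.univ.filter fun i => k ≤ i ∧ π i < k).card := by
  have : upperRight π (k + 1) =
      (Finset.univ.filter fun i => k ≤ i ∧ π i < k).image fun i => (i, π i) := by
    ext ⟨a, b⟩
    rw [upperRight, Finset.mem_filter, mem_dots, Finset.mem_image]
    simp only [Finset.mem_filter, Finset.mem_univ, true_and, Prod.mk.injEq, label, Fin.lt_def,
      Fin.le_def]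
    constructor
    · rintro ⟨rfl, h⟩
      exact ⟨a, by omega, rfl, rfl⟩
    · rintro ⟨i, h, rfl, rfl⟩
      exact ⟨rfl, by omega⟩
  rw [this, Finset.card_image_of_injective _ fun a b h => (Prod.ext_iff.1 h).1]

/-- The two quadrants have the same number of dots. -/
lemma card_quadrants_eq (π : Equiv.Perm (Fin n)) (k : Fin n) :
    (Finset.univ.filter fun i => i < k ∧ k ≤ π i).card =
      (Finset.univ.filter fun i => k ≤ i ∧ π i < k).card := by
  have h1 := Finset.card_filter_add_card_filter_not (s := Finset.univ.filter fun i => i < k)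
    (fun i => k ≤ π i)
  have h2 := Finset.card_filter_add_card_filter_not (s := Finset.univ.filter fun i => π i < k)
    (fun i => k ≤ i)
  have h3 : (Finset.univ.filter fun i => π i < k).card = (Finset.univ.filter fun i => i < k).card :=
    Finset.card_equiv π (by simp)
  simp only [Finset.filter_filter, not_le] at h1 h2
  have h4 : (Finset.univ.filter fun i => i < k ∧ π i < k) =
      Finset.univ.filter fun i => π i < k ∧ i < k := by
    simp only [and_comm]
  have h5 : (Finset.univ.filter fun i => k ≤ i ∧ π i < k) =
      Finset.univ.filter fun i => π i < k ∧ k ≤ i := by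
    simp only [and_comm]
  rw [h4] at h1
  rw [h5]
  omega

/-- The index `k` carries the label k + 1, so positive indices are the labels from 2 to n. One
quadrant suffices since both have the same size. -/
lemma quadrantCondition_iff : QuadrantCondition π ↔
    ∀ k : Fin n, 0 < (k : ℕ) → (Finset.univ.filter fun i => i < k ∧ k ≤ π i).card = 1 := by
  constructor
  · intro h k hk
    rw [← card_lowerLeft]
    exact (h _ (Finset.mem_Icc.2 ⟨by omega, by omega⟩)).1
  · intro h k hk
    obtain ⟨h2, hn⟩ := Finset.mem_Icc.1 hk
    have h1 := h ⟨k - 1, by omega⟩ (by simp only; omega)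
    have e : k = ((⟨k - 1, by omega⟩ : Fin n) : ℕ) + 1 := by simp only; omega
    rw [e, card_lowerLeft, card_upperRight, ← card_quadrants_eq]
    exact ⟨h1, h1⟩

lemma QuadrantCondition.existsUnique (h : QuadrantCondition π) :
    (∀ k : Fin n, 0 < (k : ℕ) → ∃! i, i < k ∧ k ≤ π i) ∧
      ∀ k : Fin n, 0 < (k : ℕ) → ∃! i, k ≤ i ∧ π i < k := by
  rw [quadrantCondition_iff] at h
  refine ⟨fun k hk => ?_, fun k hk => ?_⟩
  · simpa using Finset.card_eq_one_iff_existsUnique.1 (h k hk)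
  · simpa using Finset.card_eq_one_iff_existsUnique.1 ((card_quadrants_eq π k).symm.trans (h k hk))

end Quadrants

/-! ### Monotonicity of the count, and quadrants with two dots -/

section Connected

/-- Without an empty lower-left quadrant, no set of dots is separated from the other ones, even
when fixed points are ignored. -/
lemma not_separated (hL : ∀ k : Fin n, 0 < (k : ℕ) → ∃ i, i < k ∧ k ≤ π i)
    (hU : ∀ k : Fin n, 0 < (k : ℕ) → ∃ i, k ≤ i ∧ π i < k)
    {D : Finset (Fin n × Fin n)} (hD : ∀ i, π i ≠ i → (i, π i) ∈ D)
    {P : Fin n × Fin n → Prop} {o : Fin n × Fin n} (hmin : ∀ d ∈ D, o.1 ≤ d.1)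
    (ho : o ∈ D) (hPo : P o) (hex : ∃ q ∈ D, ¬ P q)
    (h : ∀ p ∈ D, ∀ q ∈ D, P p → ¬ P q →
      (p.1 < q.1 → p.2 ≤ q.2) ∧ (q.1 < p.1 → q.2 ≤ p.2)) (hDπ : D ⊆ dots π) : False := by
  classical
  obtain ⟨q, hq, hqmin⟩ := (D.filter fun q => ¬ P q).exists_min_image (fun q => q.1)
    (by obtain ⟨q, hq, hPq⟩ := hex; exact ⟨q, Finset.mem_filter.2 ⟨hq, hPq⟩⟩)
  simp only [Finset.mem_filter] at hq hqmin
  have hoq : o.1 < q.1 := by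
    refine lt_of_le_of_ne (hmin q hq.1) fun e => hq.2 ?_
    have : o = q := Prod.ext e (by rw [← mem_dots.1 (hDπ ho), ← mem_dots.1 (hDπ hq.1), e])
    exact this ▸ hPo
  have hk : 0 < (q.1 : ℕ) := lt_of_le_of_lt (Nat.zero_le _) hoq
  -- With q the leftmost dot outside `P`, the dot i of the lower-left quadrant at column q.1
  -- satisfies `P`. If j fails `P`, separation orders i and j wrongly; if j satisfies it, comparing
  -- both with q forces q.1 ≤ q.2 < q.1.
  obtain ⟨i, hi, hi'⟩ := hL q.1 hk
  obtain ⟨j, hj, hj'⟩ := hU q.1 hk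
  have hiD := hD i (hi.trans_le hi').ne'
  have hjD := hD j (hj'.trans_le hj).ne
  have hPi : P (i, π i) := by
    by_contra hn
    exact absurd (hqmin _ ⟨hiD, hn⟩) (not_le.2 hi)
  by_cases hPj : P (j, π j)
  · have h1 := (h _ hiD _ hq.1 hPi hq.2).1 hi
    have hjq : q.1 < j := by
      refine lt_of_le_of_ne hj fun e => hq.2 ?_
      have : (j, π j) = q := Prod.ext e.symm (by rw [← mem_dots.1 (hDπ hq.1), e])
      exact this ▸ hPj
    have h2 := (h _ hjD _ hq.1 hPj hq.2).2 hjq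
    exact absurd ((hi'.trans h1).trans h2) (not_le.2 hj')
  · have h1 := (h _ hiD _ hjD hPi hPj).1 (hi.trans_le hj)
    exact absurd (hi'.trans h1) (not_le.2 hj')

/-- Otherwise `S` and `D \ S` would be separated; `not_separated` applies with `P` describing
whichever part holds the leftmost dot. -/
lemma exists_adjacent (hL : ∀ k : Fin n, 0 < (k : ℕ) → ∃ i, i < k ∧ k ≤ π i)
    (hU : ∀ k : Fin n, 0 < (k : ℕ) → ∃ i, k ≤ i ∧ π i < k)
    {D S : Finset (Fin n × Fin n)} (hDπ : D ⊆ dots π) (hD : ∀ i, π i ≠ i → (i, π i) ∈ D)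
    (hS : S.Nonempty) (hSD : S ⊂ D) :
    ∃ v ∈ D, v ∉ S ∧
      ((∃ q ∈ S, v.1 < q.1 ∧ q.2 < v.2) ∨ ∃ q ∈ S, q.1 < v.1 ∧ v.2 < q.2) := by
  by_contra! hno
  obtain ⟨s, hs⟩ := hS
  obtain ⟨t, htD, htS⟩ := Finset.exists_of_ssubset hSD
  obtain ⟨o, ho, hmin⟩ := D.exists_min_image (fun q => q.1) ⟨t, htD⟩
  by_cases hoS : o ∈ S
  · exact not_separated hL hU hD (P := fun d => d ∈ S) hmin ho hoS ⟨t, htD, htS⟩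
      (fun p _ q hq hpS hqS => ⟨(hno q hq hqS).2 p hpS, (hno q hq hqS).1 p hpS⟩) hDπ
  · exact not_separated hL hU hD (P := fun d => d ∉ S) hmin ho hoS
      ⟨s, hSD.1 hs, not_not.2 hs⟩ (fun p hp q _ hpS hqS =>
        ⟨(hno p hp hpS).1 q (not_not.1 hqS), (hno p hp hpS).2 q (not_not.1 hqS)⟩) hDπ

/-- The number of trees does not decrease when the set of leaves grows. -/
lemma ncard_treesOn_mono (hL : ∀ k : Fin n, 0 < (k : ℕ) → ∃ i, i < k ∧ k ≤ π i)
    (hU : ∀ k : Fin n, 0 < (k : ℕ) → ∃ i, k ≤ i ∧ π i < k)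
    {D : Finset (Fin n × Fin n)} (hDπ : D ⊆ dots π) (hD : ∀ i, π i ≠ i → (i, π i) ∈ D) :
    ∀ S : Finset (Fin n × Fin n), S.Nonempty → S ⊆ D →
      (treesOn S).ncard ≤ (treesOn D).ncard := by
  suffices H : ∀ m : ℕ, ∀ S : Finset (Fin n × Fin n), S.Nonempty → S ⊆ D → (D \ S).card = m →
      (treesOn S).ncard ≤ (treesOn D).ncard from fun S h1 h2 => H _ S h1 h2 rfl
  intro m
  induction m with
  | zero =>
    intro S _ hSD hm
    rw [Finset.card_eq_zero, Finset.sdiff_eq_empty_iff_subset] at hm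
    rw [hSD.antisymm hm]
  | succ m ih =>
    intro S hS hSD hm
    have hss : S ⊂ D := by
      refine hSD.ssubset_of_ne ?_
      rintro rfl
      simp at hm
    obtain ⟨v, hvD, hvS, hadj⟩ := exists_adjacent hL hU hDπ hD hS hss
    refine (ncard_treesOn_insert_ge (x := v.1) (y := v.2)
      (fst_ne_of_notMem (hSD.trans hDπ) (hDπ hvD) hvS)
      (snd_ne_of_notMem (hSD.trans hDπ) (hDπ hvD) hvS) hadj).trans ?_
    refine ih _ (Finset.insert_nonempty _ _) (Finset.insert_subset hvD hSD) ?_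
    rw [Finset.sdiff_insert, Finset.card_erase_of_mem (by simp [hvD, hvS]), hm]
    rfl

/-- A quadrant with at least two dots yields at least three trees. -/
lemma three_le_ncard_treesOn_dots (hL : ∀ k : Fin n, 0 < (k : ℕ) → ∃ i, i < k ∧ k ≤ π i)
    (hU : ∀ k : Fin n, 0 < (k : ℕ) → ∃ i, k ≤ i ∧ π i < k) {k : Fin n}
    (hk : 1 < (Finset.univ.filter fun i => i < k ∧ k ≤ π i).card) :
    3 ≤ (treesOn (dots π)).ncard := by
  have hk' := hk
  rw [card_quadrants_eq] at hk'
  obtain ⟨a, ha, b, hb, hab⟩ : ∃ a, (a < k ∧ k ≤ π a) ∧ ∃ b, (b < k ∧ k ≤ π b) ∧ a < b := by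
    obtain ⟨a, ha, b, hb, hne⟩ := Finset.one_lt_card.1 hk
    simp only [Finset.mem_filter, Finset.mem_univ, true_and] at ha hb
    rcases lt_or_gt_of_ne hne with h | h
    exacts [⟨a, ha, b, hb, h⟩, ⟨b, hb, a, ha, h⟩]
  -- The upper-right pair is ordered by row, the lower-left pair by column, as
  -- `three_le_ncard_treesOn` requires.
  obtain ⟨e, he, f, hf, hef⟩ : ∃ e, (k ≤ e ∧ π e < k) ∧ ∃ f, (k ≤ f ∧ π f < k) ∧ π e < π f := by
    obtain ⟨a, ha, b, hb, hne⟩ := Finset.one_lt_card.1 hk'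
    simp only [Finset.mem_filter, Finset.mem_univ, true_and] at ha hb
    rcases lt_or_gt_of_ne (π.injective.ne hne) with h | h
    exacts [⟨a, ha, b, hb, h⟩, ⟨b, hb, a, ha, h⟩]
  refine (three_le_ncard_treesOn hab (hb.1.trans_le he.1) (hb.1.trans_le hf.1)
    (fun h => hef.ne (by rw [h])) hef (hf.2.trans_le ha.2) (hf.2.trans_le hb.2)
    (π.injective.ne hab.ne)).trans
    (ncard_treesOn_mono hL hU subset_rfl (fun i _ => by simp) _ (by simp) ?_)
  intro d hd
  simp only [Finset.mem_insert, Finset.mem_singleton] at hd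
  rcases hd with rfl | rfl | rfl | rfl <;> simp

end Connected

/-! ### Uniqueness of the tree without fixed points -/

section UpperBounds

/-- Under the quadrant condition there is at most one tree on a set of dots that are not fixed
points. -/
lemma ncard_treesOn_le_one (hL : ∀ k : Fin n, 0 < (k : ℕ) → ∃! i, i < k ∧ k ≤ π i)
    (hU : ∀ k : Fin n, 0 < (k : ℕ) → ∃! i, k ≤ i ∧ π i < k) :
    ∀ S : Finset (Fin n × Fin n), S ⊆ dots π → (∀ d ∈ S, d.1 ≠ d.2) →
      (treesOn S).ncard ≤ 1 := by
  intro S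
  induction S using Finset.strongInduction with
  | H S ih =>
    intro hSπ hfix
    rcases S.eq_empty_or_nonempty with rfl | hS
    · simp [treesOn_empty]
    -- Peel off a dot with min(column, row) maximal. If x < y, use the quadrants at x + 1: by
    -- maximality every dot to the upper right is the unique dot of the upper-right quadrant, while
    -- a dot to the lower left would join (x, y) in the lower-left one. The case y < x is symmetric.
    obtain ⟨⟨x, y⟩, hv, hmax⟩ := S.exists_max_image (fun d => min d.1 d.2) hS
    set S' := S.erase (x, y) with hS'
    have hins : S = insert (x, y) S' := (Finset.insert_erase hv).symm
    rcases S'.eq_empty_or_nonempty with h0 | hne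
    · rw [hins, h0]
      simp [treesOn_singleton]
    have hS'S : S' ⊆ S := Finset.erase_subset _ _
    have hvS' : (x, y) ∉ S' := Finset.notMem_erase _ _
    have hx := fst_ne_of_notMem (hS'S.trans hSπ) (hSπ hv) hvS'
    have hy := snd_ne_of_notMem (hS'S.trans hSπ) (hSπ hv) hvS'
    have hxy : π x = y := by simpa using hSπ hv
    have hπ : ∀ q ∈ S', π q.1 = q.2 := fun q hq => mem_dots.1 (hSπ (hS'S hq))
    have hmin : ∀ q ∈ S', min q.1 q.2 ≤ min x y := fun q hq => hmax q (hS'S hq)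
    refine le_trans ?_ (ih S' (Finset.erase_ssubset hv) (hS'S.trans hSπ)
      fun d hd => hfix d (hS'S hd))
    rw [hins]
    rcases lt_or_gt_of_ne (hfix _ hv) with hlt | hlt
    · simp only at hlt
      obtain ⟨k, hk⟩ : ∃ k : Fin n, (k : ℕ) = x + 1 := ⟨⟨x + 1, by omega⟩, rfl⟩
      have hLk := fun {i j} => (hL k (by omega)).unique (y₁ := i) (y₂ := j)
      obtain ⟨i, -, hi⟩ := hU k (by omega)
      refine ncard_treesOn_insert_le_above (z := π i) hne hx hy ?_ ?_
      · intro q hq h1 h2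
        have h3 := hmin q hq
        rw [min_eq_left hlt.le, min_le_iff] at h3
        have h4 : q.1 = i := hi _ ⟨by rw [Fin.le_def]; omega, by rw [hπ q hq, Fin.lt_def]; omega⟩
        rw [← hπ q hq, h4]
      · intro q hq h1
        by_contra h2
        refine h1.ne (hLk ⟨?_, ?_⟩ ⟨?_, ?_⟩)
        · rw [Fin.lt_def]; omega
        · rw [hπ q hq, Fin.le_def]; omega
        · rw [Fin.lt_def]; omega
        · rw [hxy, Fin.le_def]; omega
    · simp only at hlt
      obtain ⟨k, hk⟩ : ∃ k : Fin n, (k : ℕ) = y + 1 := ⟨⟨y + 1, by omega⟩, rfl⟩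
      have hUk := fun {i j} => (hU k (by omega)).unique (y₁ := i) (y₂ := j)
      obtain ⟨i, -, hi⟩ := hL k (by omega)
      refine ncard_treesOn_insert_le_left (w := i) hne hx hy ?_ ?_
      · intro q hq h1
        by_contra h2
        refine h1.ne' (hUk ⟨?_, ?_⟩ ⟨?_, ?_⟩)
        · rw [Fin.le_def]; omega
        · rw [hπ q hq, Fin.lt_def]; omega
        · rw [Fin.le_def]; omega
        · rw [hxy, Fin.lt_def]; omega
      · intro q hq h1 h2
        have h3 := hmin q hq
        rw [min_eq_right hlt.le, min_le_iff] at h3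
        exact hi _ ⟨by rw [Fin.lt_def]; omega, by rw [hπ q hq, Fin.le_def]; omega⟩

end UpperBounds

/-! ### Adding fixed points -/

section FixedPoints

/-- The dots of `π` that are not fixed points. -/
def nonfixedDots (π : Equiv.Perm (Fin n)) : Finset (Fin n × Fin n) :=
  (dots π).filter fun d => d.1 ≠ d.2

@[simp] lemma mem_nonfixedDots {d : Fin n × Fin n} :
    d ∈ nonfixedDots π ↔ π d.1 = d.2 ∧ d.1 ≠ d.2 := by
  simp [nonfixedDots]

lemma nonfixedDots_subset (π : Equiv.Perm (Fin n)) : nonfixedDots π ⊆ dots π :=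
  Finset.filter_subset _ _

lemma nonfixedDots_nonempty (hL : ∀ k : Fin n, 0 < (k : ℕ) → ∃ i, i < k ∧ k ≤ π i) {k : Fin n}
    (hk : 0 < (k : ℕ)) : (nonfixedDots π).Nonempty := by
  obtain ⟨i, h1, h2⟩ := hL k hk
  exact ⟨(i, π i), by simpa using (h1.trans_le h2).ne⟩

lemma one_le_ncard_treesOn_nonfixedDots
    (hL : ∀ k : Fin n, 0 < (k : ℕ) → ∃ i, i < k ∧ k ≤ π i)
    (hU : ∀ k : Fin n, 0 < (k : ℕ) → ∃ i, k ≤ i ∧ π i < k) {k : Fin n} (hk : 0 < (k : ℕ)) :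
    1 ≤ (treesOn (nonfixedDots π)).ncard := by
  obtain ⟨v, hv⟩ := nonfixedDots_nonempty hL hk
  have := ncard_treesOn_mono hL hU (nonfixedDots_subset π)
    (fun i hi => by simpa using Ne.symm hi) {v} (by simp) (by simpa using hv)
  rwa [treesOn_singleton, Set.ncard_singleton] at this

variable {S : Finset (Fin n × Fin n)} {j : Fin n}

/-- Row j and column j are used up by (j, j), so the dots in the two quadrants at j lie strictly to
its lower left and upper right; being nonfixed, they belong to `S`. -/
lemma two_mul_ncard_treesOn_le_insert_fixed
    (hL : ∀ k : Fin n, 0 < (k : ℕ) → ∃ i, i < k ∧ k ≤ π i)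
    (hU : ∀ k : Fin n, 0 < (k : ℕ) → ∃ i, k ≤ i ∧ π i < k)
    (hS : S ⊆ dots π) (hD : ∀ i, π i ≠ i → (i, π i) ∈ S) (h0 : 0 < (j : ℕ)) (hj : π j = j)
    (hjS : (j, j) ∉ S) :
    2 * (treesOn S).ncard ≤ (treesOn (insert (j, j) S)).ncard := by
  have hv : (j, j) ∈ dots π := by simpa using hj
  refine two_mul_ncard_treesOn_le_insert (fst_ne_of_notMem hS hv hjS)
    (snd_ne_of_notMem hS hv hjS) ?_ ?_
  · obtain ⟨i, h1, h2⟩ := hU j h0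
    exact ⟨_, hD i (h2.trans_le h1).ne, lt_of_le_of_ne h1 fun (e : j = i) => h2.ne (by rw [← e, hj]), h2⟩
  · obtain ⟨i, h1, h2⟩ := hL j h0
    exact ⟨_, hD i (h1.trans_le h2).ne', h1,
      lt_of_le_of_ne h2 fun (e : j = π i) => h1.ne (π.injective (by rw [← e, hj]))⟩

lemma ncard_treesOn_insert_fixed_le
    (hL : ∀ k : Fin n, 0 < (k : ℕ) → ∃! i, i < k ∧ k ≤ π i)
    (hU : ∀ k : Fin n, 0 < (k : ℕ) → ∃! i, k ≤ i ∧ π i < k)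
    (hne : S.Nonempty) (hS : S ⊆ dots π) (h0 : 0 < (j : ℕ)) (hj : π j = j) (hjS : (j, j) ∉ S) :
    (treesOn (insert (j, j) S)).ncard ≤ 2 * (treesOn S).ncard := by
  have hv : (j, j) ∈ dots π := by simpa using hj
  obtain ⟨a, -, ha⟩ := hL j h0
  obtain ⟨b, -, hb⟩ := hU j h0
  have hπ : ∀ q ∈ S, π q.1 = q.2 := fun q hq => mem_dots.1 (hS hq)
  refine ncard_treesOn_insert_le_two_mul (z := π b) (w := a) hne (fst_ne_of_notMem hS hv hjS)
    (snd_ne_of_notMem hS hv hjS) ?_ ?_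
  · intro q hq h1 h2
    rw [← hπ q hq] at h2 ⊢
    rw [hb _ ⟨h1.le, h2⟩]
  · intro q hq h1 h2
    rw [← hπ q hq] at h2
    exact ha _ ⟨h1, h2.le⟩

end FixedPoints

/-! ### CNATs as trees on the dots of π -/

section CNATs

/-- In a nonempty grid, the trees whose leaves are the dots of `π` are the CNATs of `π`. -/
lemma CNATs_eq_treesOn (hn : 0 < n) : CNATs π = treesOn (dots π) := by
  ext T
  constructor
  · rintro ⟨hT, hl⟩
    have hroot : ∃ o ∈ T, IsTopLeft o := by
      obtain ⟨y, hy⟩ := hT.column_nonempty ⟨0, hn⟩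
      -- A dot of minimal index sum has no parent, so it must be the top-left cell.
      obtain ⟨⟨a, b⟩, ho, hmin⟩ := T.exists_min_image (fun d => (d.1 : ℕ) + d.2) ⟨_, hy⟩
      refine ⟨_, ho, ?_⟩
      by_contra hnot
      rcases hT.unique_parent _ ho hnot with ⟨⟨z, hz, hzT⟩, -⟩ | ⟨-, ⟨z, hz, hzT⟩⟩
      · have := hmin _ hzT
        simp only [Fin.lt_def] at this hz
        omega
      · have := hmin _ hzT
        simp only [Fin.lt_def] at this hz
        omega
    obtain ⟨o, ho, ho1, ho2⟩ := hroot
    refine ⟨fun d => ?_, ⟨o, ho, fun d hd hne => hT.unique_parent d hd fun h => hne ?_⟩,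
      hT.complete⟩
    · rw [← Finset.mem_coe, ← hl]
      rfl
    · exact Prod.ext (Fin.ext (h.1.trans ho1.symm)) (Fin.ext (h.2.trans ho2.symm))
  · intro (hT : IsTreeOn T (dots π))
    have hcol : ∀ x, (x, π x) ∈ T := fun x => hT.leaves_subset (by simp)
    have hrow : ∀ y, (π.symm y, y) ∈ T := fun y => hT.leaves_subset (by simp)
    refine ⟨⟨⟨fun x => ⟨_, hcol x⟩, fun y => ⟨_, hrow y⟩, fun d hd htl => ?_⟩, hT.complete⟩, ?_⟩
    · obtain ⟨o, ho, hole, hp⟩ := hT.exists_root_le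
      refine hp d hd ?_
      rintro rfl
      have h1 := (hole _ (hcol ⟨0, hn⟩)).1
      have h2 := (hole _ (hrow ⟨0, hn⟩)).2
      exact htl ⟨by simpa [Fin.le_def] using h1, by simpa [Fin.le_def] using h2⟩
    · ext d
      exact (hT.mem_leaves d).symm

/-- There is no CNAT when a lower-left quadrant is empty. -/
lemma CNATs_eq_empty {k : Fin n} (hk : 0 < (k : ℕ)) (hL : ∀ i, i < k → π i < k) :
    CNATs π = ∅ := by
  rw [CNATs_eq_treesOn (hk.trans k.2)]
  have hU : ∀ i, k ≤ i → k ≤ π i := by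
    have := card_quadrants_eq π k
    rw [Finset.filter_false_of_mem (by simpa using hL), Finset.card_empty, eq_comm,
      Finset.card_eq_zero, Finset.filter_eq_empty_iff] at this
    simpa using this
  refine Set.eq_empty_of_forall_notMem fun T (hT : IsTreeOn T (dots π)) => ?_
  obtain ⟨o, ho, hole, hp⟩ := hT.exists_root_le
  have hcol : ∀ x y, (x, y) ∈ T → y ≤ π x := by
    intro x y hd
    obtain ⟨y', h1, h2⟩ := hT.exists_leaf_column hd
    rw [mem_dots] at h2
    exact h2 ▸ h1
  have hrow : ∀ x y, (x, y) ∈ T → x ≤ π.symm y := by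
    intro x y hd
    obtain ⟨x', h1, h2⟩ := hT.exists_leaf_row hd
    rw [mem_dots] at h2
    rwa [← show π x' = y from h2, Equiv.symm_apply_apply]
  -- The leaves closing the row and the column of a dot confine it to one of two diagonal blocks. A
  -- parent shares a row or column, hence the block, so the leaf in column k is cut off from the
  -- root.
  have key : ∀ x y, (x, y) ∈ T → (x < k ↔ y < k) := by
    intro x y hd
    constructor
    · exact fun h => (hcol x y hd).trans_lt (hL x h)
    · intro h
      refine (hrow x y hd).trans_lt (not_le.1 fun h' => ?_)
      have := hU _ h'
      rw [Equiv.apply_symm_apply] at this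
      exact absurd h (not_lt.2 this)
  have hlt : ∀ d ∈ T, d.1 < k := by
    refine IsTreeOn.parent_induction (fun d hd hne => by have := hp d hd hne; tauto) ?_ ?_ ?_
    · refine (hole _ (hT.leaves_subset (?_ : (⟨0, hk.trans k.2⟩, π ⟨0, hk.trans k.2⟩) ∈ _))).1.trans_lt hk
      simp
    · exact fun _ _ _ _ _ _ h => h
    · intro x x' y _ hd hd' h
      exact (key x y hd).2 ((key x' y hd').1 h)
  exact lt_irrefl k (hlt (k, π k) (hT.leaves_subset (by simp)))

end CNATs

end Permutations

end NonAmbiguousTree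

/-! ### The characterization -/

open NonAmbiguousTree in
theorem mainTheorem10 (n : ℕ) (π : Equiv.Perm (Fin n)) :
    NonAmbiguousTree.cnat π = 2 ↔
      NonAmbiguousTree.QuadrantCondition π ∧
        ∃ j : Fin n, 2 ≤ NonAmbiguousTree.label j ∧ π j = j ∧ ∀ i : Fin n, π i = i → i = j := by
  have label_iff : ∀ j : Fin n, 2 ≤ label j ↔ 0 < (j : ℕ) := fun j => by rw [label]; omega
  constructor
  · intro h
    have hn : 1 < n := by
      by_contra hn
      have hsub : Subsingleton (Fin n) := ⟨fun a b => Fin.ext (by omega)⟩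
      rcases Nat.eq_zero_or_pos n with rfl | hpos
      -- For n = 0 the empty filling is a CNAT but not a tree in the sense of `IsTreeOn`, so this
      -- case is counted directly.
      · have := Set.ncard_le_one_of_subsingleton (CNATs π)
        rw [cnat] at h
        omega
      · have hdots : dots π = {(⟨0, hpos⟩, ⟨0, hpos⟩)} := by
          ext d
          simp [Subsingleton.elim d (⟨0, hpos⟩, ⟨0, hpos⟩), Subsingleton.elim (π _) ⟨0, hpos⟩]
        rw [cnat, CNATs_eq_treesOn hpos, hdots, treesOn_singleton, Set.ncard_singleton] at h
        omega
    have hcard : ∀ k : Fin n, 0 < (k : ℕ) →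
        0 < (Finset.univ.filter fun i => i < k ∧ k ≤ π i).card := by
      intro k hk
      rw [Finset.card_pos]
      by_contra hemp
      rw [Finset.not_nonempty_iff_eq_empty, Finset.filter_eq_empty_iff] at hemp
      rw [cnat, CNATs_eq_empty hk (fun i hi => not_le.1 fun h' => hemp (Finset.mem_univ i) ⟨hi, h'⟩),
        Set.ncard_empty] at h
      omega
    have hL : ∀ k : Fin n, 0 < (k : ℕ) → ∃ i, i < k ∧ k ≤ π i := by
      intro k hk
      obtain ⟨i, hi⟩ := Finset.card_pos.1 (hcard k hk)
      exact ⟨i, by simpa using hi⟩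
    have hU : ∀ k : Fin n, 0 < (k : ℕ) → ∃ i, k ≤ i ∧ π i < k := by
      intro k hk
      have := hcard k hk
      rw [card_quadrants_eq] at this
      obtain ⟨i, hi⟩ := Finset.card_pos.1 this
      exact ⟨i, by simpa using hi⟩
    rw [cnat, CNATs_eq_treesOn (by omega)] at h
    have hQ : QuadrantCondition π := by
      refine quadrantCondition_iff.2 fun k hk => le_antisymm (not_lt.1 fun hlt => ?_) (hcard k hk)
      have := three_le_ncard_treesOn_dots hL hU hlt
      omega
    obtain ⟨hL1, hU1⟩ := hQ.existsUnique
    -- If index 0 were fixed, the lower-left quadrant at index 1 would be empty.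
    have hpos : ∀ j, π j = j → 0 < (j : ℕ) := by
      intro j hj
      by_contra h0
      obtain ⟨i, hi, hi'⟩ := hL ⟨1, hn⟩ (by simp)
      have : i = j := Fin.ext (by rw [Fin.lt_def] at hi; simp only at hi; omega)
      rw [this, hj, Fin.le_def] at hi'
      simp only at hi'
      omega
    refine ⟨hQ, ?_⟩
    by_contra! hno
    by_cases hf : ∃ j, π j = j
    · obtain ⟨j, hj⟩ := hf
      obtain ⟨i, hi, hne⟩ := hno j ((label_iff j).2 (hpos j hj)) hj
      -- Two fixed points double the count twice, from at least 1 to at least 4, and monotonicity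
      -- carries this to all of `dots π`.
      have h1 := one_le_ncard_treesOn_nonfixedDots hL hU (hpos j hj)
      have h2 := two_mul_ncard_treesOn_le_insert_fixed hL hU (nonfixedDots_subset π)
        (fun i hi => by simpa using Ne.symm hi) (hpos j hj) hj (by simp)
      have hsub : insert (j, j) (nonfixedDots π) ⊆ dots π :=
        Finset.insert_subset (by simpa using hj) (nonfixedDots_subset π)
      have h3 := two_mul_ncard_treesOn_le_insert_fixed hL hU hsub
        (fun i hi => Finset.mem_insert_of_mem (by simpa using Ne.symm hi)) (hpos i hi) hi
        (by simpa using hne)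
      have h4 := ncard_treesOn_mono hL hU subset_rfl (fun i _ => by simp) _
        (Finset.insert_nonempty (i, i) _) (Finset.insert_subset (by simpa using hi) hsub)
      omega
    · push Not at hf
      have := ncard_treesOn_le_one hL1 hU1 (dots π) subset_rfl (fun d hd e => hf d.1 (by
        rw [mem_dots.1 hd, e]))
      omega
  · rintro ⟨hQ, j, hj, hjπ, huniq⟩
    rw [label_iff] at hj
    obtain ⟨hL1, hU1⟩ := hQ.existsUnique
    have hL := fun k hk => (hL1 k hk).exists
    have hU := fun k hk => (hU1 k hk).exists
    have hdots : dots π = insert (j, j) (nonfixedDots π) := by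
      ext ⟨a, b⟩
      simp only [mem_dots, Finset.mem_insert, mem_nonfixedDots, Prod.mk.injEq]
      constructor
      · intro hab
        by_cases he : a = b
        · have := huniq a (hab.trans he.symm)
          exact .inl ⟨this, he ▸ this⟩
        · exact .inr ⟨hab, he⟩
      · rintro (⟨rfl, rfl⟩ | hab)
        exacts [hjπ, hab.1]
    have h1 := one_le_ncard_treesOn_nonfixedDots hL hU hj
    have h2 := two_mul_ncard_treesOn_le_insert_fixed hL hU (nonfixedDots_subset π)
      (fun i hi => by simpa using Ne.symm hi) hj hjπ (by simp)
    have h3 := ncard_treesOn_insert_fixed_le hL1 hU1 (nonfixedDots_nonempty hL hj)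
      (nonfixedDots_subset π) hj hjπ (by simp)
    have h4 := ncard_treesOn_le_one hL1 hU1 (nonfixedDots π) (nonfixedDots_subset π)
      (fun d hd => (mem_nonfixedDots.1 hd).2)
    rw [cnat, CNATs_eq_treesOn (hj.trans j.2), hdots]
    omega
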